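/- Let $B_m$ denote the Bernoulli numbers, defined by $\frac{t}{e^t-1}=\sum_{m\ge 0}B_m\frac{t^m}{m!}$, and for a function $f$ of two variables write $\mathrm{Cyc}_{x,y}\,f(x,y)=f(x,y)+f(y,x)$. For all nonnegative integers $r_1,r_2$ and all integers $n\ge r_1+r_2+2$, $$ \begin{aligned} &\sum_{k=\lceil (r_1+r_2)/2\rceil+1}^{\,n-\lceil (r_1+r_2)/2\rceil-1} \frac{B_{2k}}{(2k)!}\,\frac{B_{2j}}{(2j)!}\binom{2k-1}{r_1}\binom{2j-1}{r_2}\\ &\quad=-\left(\binom{2n-1}{r_1+r_2+1}+\mathrm{Cyc}_{r_1,r_2}\,(-1)^{r_2}\binom{2n-1}{r_1}\right)\frac{B_{2n}}{(2n)!}\\ &\qquad-\mathrm{Cyc}_{r_1,r_2}\sum_{k=\lceil r_1/2\rceil+1}^{\lfloor (r_1+r_2+1)/2\rfloor} \binom{2k-1}{r_1}\left((-1)^{r_1}\binom{2j-1}{r_1+r_2+1-2k}+\binom{2j-1}{r_2}\right)\frac{B_{2k}}{(2k)!}\,\frac{B_{2j}}{(2j)!}, \end{aligned} $$ where $j=n-k$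 in every sum, and a sum whose lower limit exceeds its upper limit is $0$. -/

import Mathlib

/-- The symmetrization `f(x, y) + f(y, x)` of a function of two natural numbers. -/
def cyc (f : ℕ → ℕ → ℚ) (x y : ℕ) : ℚ := f x y + f y x

/-!
Write `β m = B_m / m!`. The series `g(x) = ∑_{k ≥ 1} β(2k) x²ᵏ⁻¹` is `coth (x / 2) / 2 - 1 / x`, so
the addition theorem of `coth` gives, for `x = y + z`, a quadratic relation between `g(x)`, `g(y)`
and `g(z)`. Its homogeneous part of degree `2n - 2` is
`P(x, y) - P(z, y) + P(z, x) = β(2n) (z²ⁿ/(xy) - x²ⁿ⁻¹/y - y²ⁿ⁻¹/x - (x²ⁿ⁻¹ - y²ⁿ⁻¹)/z)`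
with `P(x, y) = ∑_{k=1}^{n-1} β(2k) β(2n-2k) x²ᵏ⁻¹ y²ⁿ⁻²ᵏ⁻¹` (`bernoulliConvolution_relation`).

Put `x = 1 + X`, `y = 1 + Y`, `z = X - Y` and compare coefficients of `Xʳ Yˢ`. The term `P(x, y)`
gives the convolution with binomial weights over the full range `1 ≤ k ≤ n - 1`; the terms
`P(z, y)` and `P(z, x)` give short sums, since a power of `z` contributes only up to degree `r + s`;
and `z²ⁿ/(xy)` contributes nothing, as `r + s < 2n` (`sum_bernoulli_mul_choose`). The theorem follows
by moving the two ends of the full range to the other side, where they merge with the short sums.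

The addition theorem is proved in `R⟦T⟧`, with `x, y` elements of a domain `R` and
`g` rescaled by them; the substitution above takes place in `R = ℚ⟦X⟧⟦Y⟧`, where `X` is the
constant series `C X` and `Y` is the variable `X : ℚ⟦X⟧⟦X⟧`.
-/

open PowerSeries Finset

/-! ### The addition theorem of the hyperbolic cotangent -/

section Coth

variable {R : Type*} [CommRing R] [Algebra ℚ R]

/-- The power series `∑ₖ B₂ₖ / (2k)! T²ᵏ = (T / 2) coth (T / 2)` over a `ℚ`-algebra, obtained from
`T / (exp T - 1)` by removing the linear term. -/
noncomputable def evenBernoulliSeries (R : Type*) [CommRing R] [Algebra ℚ R] : R⟦X⟧ :=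
  bernoulliPowerSeries R + C (algebraMap ℚ R (1 / 2)) * X

lemma coeff_evenBernoulliSeries (m : ℕ) :
    coeff m (evenBernoulliSeries R) = algebraMap ℚ R (bernoulli m / m.factorial)
      + algebraMap ℚ R (1 / 2) * if m = 1 then 1 else 0 := by
  rw [evenBernoulliSeries, bernoulliPowerSeries, map_add, coeff_mk, coeff_C_mul, coeff_X]

lemma coeff_evenBernoulliSeries_two_mul (k : ℕ) :
    coeff (2 * k) (evenBernoulliSeries R)
      = algebraMap ℚ R (bernoulli (2 * k) / (2 * k).factorial) := by
  rw [coeff_evenBernoulliSeries, if_neg (by omega), mul_zero, add_zero]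

lemma coeff_evenBernoulliSeries_of_odd {m : ℕ} (hm : Odd m) :
    coeff m (evenBernoulliSeries R) = 0 := by
  rw [coeff_evenBernoulliSeries]
  rcases eq_or_ne m 1 with rfl | h
  · rw [if_pos rfl, mul_one, ← map_add, bernoulli_one]
    norm_num
  · rw [bernoulli_eq_zero_of_odd hm (by have := hm.pos; omega), if_neg h]
    simp

/-- With `h` the even Bernoulli series, `h(xT) (exp (xT) - 1) = (xT / 2) (exp (xT) + 1)`. -/
lemma rescale_evenBernoulliSeries_mul (x : R) :
    rescale x (evenBernoulliSeries R) * (rescale x (exp R) - 1)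
      = C (algebraMap ℚ R (1 / 2)) * (C x * X) * (rescale x (exp R) + 1) := by
  have h2 : C (algebraMap ℚ R (1 / 2)) * 2 = (1 : R⟦X⟧) := by
    rw [show (2 : R⟦X⟧) = C (algebraMap ℚ R 2) by rw [map_ofNat, map_ofNat], ← map_mul, ← map_mul]
    norm_num
  have h := congrArg (rescale x) (bernoulliPowerSeries_mul_exp_sub_one R)
  simp only [map_mul, map_sub, map_one, rescale_X] at h
  simp only [evenBernoulliSeries, map_add, map_mul, rescale_X]
  rw [show rescale x (C (algebraMap ℚ R (1 / 2))) = C (algebraMap ℚ R (1 / 2)) by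
    ext m; rcases m with _ | m <;> simp]
  linear_combination h - C x * X * h2

lemma rescale_exp_sub_one_ne_zero {x : R} (hx : x ≠ 0) : rescale x (exp R) - 1 ≠ 0 := by
  intro h
  have := congrArg (coeff 1) h
  simp [coeff_exp, coeff_one] at this
  exact hx this

/-- The addition theorem `coth ((x + y) / 2) (coth (x / 2) + coth (y / 2))
= 1 + coth (x / 2) coth (y / 2)`, cleared of denominators. -/
lemma rescale_evenBernoulliSeries_add [IsDomain R] {x y : R} (hx : x ≠ 0) (hy : y ≠ 0)
    (hxy : x + y ≠ 0) :
    C (x + y) * (rescale x (evenBernoulliSeries R) * rescale y (evenBernoulliSeries R))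
        + C (algebraMap ℚ R (1 / 4) * (x * y * (x + y))) * X ^ 2
      = C x * (rescale (x + y) (evenBernoulliSeries R) * rescale y (evenBernoulliSeries R))
        + C y * (rescale (x + y) (evenBernoulliSeries R) * rescale x (evenBernoulliSeries R)) := by
  have hq : C (algebraMap ℚ R (1 / 4)) = C (algebraMap ℚ R (1 / 2)) ^ 2 := by
    rw [← map_pow, ← map_pow]; norm_num
  have h1 := rescale_evenBernoulliSeries_mul x
  have h2 := rescale_evenBernoulliSeries_mul y
  have h3 := rescale_evenBernoulliSeries_mul (x + y)
  have e1 := rescale_exp_sub_one_ne_zero hx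
  have e2 := rescale_exp_sub_one_ne_zero hy
  have e3 := rescale_exp_sub_one_ne_zero hxy
  rw [← exp_mul_exp_eq_exp_add] at h3 e3
  simp only [map_mul, map_add, hq] at *
  generalize rescale x (exp R) = E at *
  generalize rescale y (exp R) = F at *
  generalize rescale x (evenBernoulliSeries R) = a at *
  generalize rescale y (evenBernoulliSeries R) = b at *
  generalize rescale (x + y) (evenBernoulliSeries R) = c at *
  generalize C (algebraMap ℚ R (1 / 2)) = q at *
  -- After multiplication by `(E - 1) (F - 1) (E F - 1)`, where `E = exp (xT)` and `F = exp (yT)`,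
  -- every series is eliminated in favour of `E` and `F`.
  refine mul_right_cancel₀ (mul_ne_zero (mul_ne_zero e1 e2) e3) ?_
  generalize (C x : R⟦X⟧) = u at *
  generalize (C y : R⟦X⟧) = v at *
  linear_combination ((u + v) * b * (F - 1) * (E * F - 1) - v * c * (F - 1) * (E * F - 1)) * h1
    + ((u + v) * (q * (u * X) * (E + 1)) * (E * F - 1) - u * c * (E - 1) * (E * F - 1)) * h2
    + (- u * (E - 1) * (q * (v * X) * (F + 1)) - v * (F - 1) * (q * (u * X) * (E + 1))) * h3

/-- The coefficient of `T²ⁿ` in a product of two rescaled series. -/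
lemma coeff_rescale_evenBernoulliSeries_mul (n : ℕ) (x y : R) :
    coeff (2 * n) (rescale x (evenBernoulliSeries R) * rescale y (evenBernoulliSeries R))
      = ∑ k ∈ range (n + 1), algebraMap ℚ R (bernoulli (2 * k) / (2 * k).factorial
          * (bernoulli (2 * (n - k)) / (2 * (n - k)).factorial))
          * (x ^ (2 * k) * y ^ (2 * (n - k))) := by
  rw [coeff_mul, Nat.sum_antidiagonal_eq_sum_range_succ
    (f := fun i j => coeff i (rescale x (evenBernoulliSeries R))
      * coeff j (rescale y (evenBernoulliSeries R)))]
  symm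
  refine sum_of_injOn (fun k => 2 * k) (fun a _ b _ h => by simpa using h) ?_ ?_ ?_
  · intro k hk
    simp only [coe_range, Set.mem_Iio] at *
    omega
  · intro m hm hm'
    rcases Nat.even_or_odd m with ⟨k, rfl⟩ | ho
    · exact absurd ⟨k, by simp only [mem_range, coe_range, Set.mem_Iio] at *; omega, by simp; omega⟩ hm'
    · simp [coeff_rescale, coeff_evenBernoulliSeries_of_odd ho]
  · intro k hk
    rw [← Nat.mul_sub, coeff_rescale, coeff_rescale, coeff_evenBernoulliSeries_two_mul,
      coeff_evenBernoulliSeries_two_mul, map_mul]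
    ring

/-- The homogeneous part of degree `2n - 2` of `g(x) g(y)`, where
`g(x) = ∑_{k ≥ 1} B₂ₖ / (2k)! x²ᵏ⁻¹ = coth (x / 2) / 2 - 1 / x`. -/
noncomputable def bernoulliConvolution (n : ℕ) (x y : R) : R :=
  ∑ k ∈ Icc 1 (n - 1), algebraMap ℚ R (bernoulli (2 * k) / (2 * k).factorial
    * (bernoulli (2 * (n - k)) / (2 * (n - k)).factorial))
    * (x ^ (2 * k - 1) * y ^ (2 * (n - k) - 1))

/-- The terms `k = 0` and `k = n` split off, and the remaining ones are divisible by `x y`. -/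
lemma coeff_rescale_evenBernoulliSeries_mul_eq {n : ℕ} (hn : 1 ≤ n) (x y : R) :
    coeff (2 * n) (rescale x (evenBernoulliSeries R) * rescale y (evenBernoulliSeries R))
      = x * y * bernoulliConvolution n x y
        + algebraMap ℚ R (bernoulli (2 * n) / (2 * n).factorial) * (x ^ (2 * n) + y ^ (2 * n)) := by
  rw [coeff_rescale_evenBernoulliSeries_mul, sum_range_succ, range_eq_Ico,
    sum_eq_sum_Ico_succ_bot (by omega)]
  have h : Ico (0 + 1) n = Icc 1 (n - 1) := by ext; simp; omega
  have hs : ∑ k ∈ Icc 1 (n - 1), algebraMap ℚ R (bernoulli (2 * k) / (2 * k).factorial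
          * (bernoulli (2 * (n - k)) / (2 * (n - k)).factorial))
          * (x ^ (2 * k) * y ^ (2 * (n - k))) = x * y * bernoulliConvolution n x y := by
    rw [bernoulliConvolution, mul_sum]
    refine sum_congr rfl fun k hk => ?_
    rw [mem_Icc] at hk
    obtain ⟨a, ha⟩ : ∃ a, 2 * k = a + 1 := ⟨2 * k - 1, by omega⟩
    obtain ⟨b, hb⟩ : ∃ b, 2 * (n - k) = b + 1 := ⟨2 * (n - k) - 1, by omega⟩
    rw [ha, hb]
    simp only [Nat.add_sub_cancel]
    ring
  rw [h, hs]
  simp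
  ring

/-- The degree `2n - 2` part of the addition theorem for `coth`, for the triple `x = y + z`. The
condition `2 ≤ n` excludes the constant `1 / 4`. The sum over `i` is `(x²ⁿ⁻¹ - y²ⁿ⁻¹) / z`. -/
lemma bernoulliConvolution_relation [IsDomain R] {n : ℕ} (hn : 2 ≤ n) {x y z : R} (hx : x ≠ 0)
    (hy : y ≠ 0) (hz : z ≠ 0) (h : x = y + z) :
    x * y * (bernoulliConvolution n x y - bernoulliConvolution n z y + bernoulliConvolution n z x)
      = algebraMap ℚ R (bernoulli (2 * n) / (2 * n).factorial)
        * (z ^ (2 * n) - x ^ (2 * n) - y ^ (2 * n)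
          - x * y * ∑ i ∈ range (2 * n - 1), x ^ i * y ^ (2 * n - 1 - 1 - i)) := by
  subst h
  have key := congrArg (coeff (2 * n)) (rescale_evenBernoulliSeries_add hz hy (by rwa [add_comm]))
  have hX : coeff (2 * n) (X ^ 2 : R⟦X⟧) = 0 := by
    rw [coeff_X_pow, if_neg (by omega)]
  rw [mul_comm (rescale (z + y) _) (rescale z _), add_comm z y] at key
  simp only [map_add (coeff (2 * n)), coeff_C_mul, hX,
    coeff_rescale_evenBernoulliSeries_mul_eq (show 1 ≤ n by omega)] at key
  have hQ := (Commute.all (y + z) y).geom_sum₂_mul (2 * n - 1)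
  generalize ∑ i ∈ range (2 * n - 1), (y + z) ^ i * y ^ (2 * n - 1 - 1 - i) = Q at *
  obtain ⟨m, hm⟩ : ∃ m, 2 * n = m + 1 := ⟨2 * n - 1, by omega⟩
  generalize algebraMap ℚ R (bernoulli (2 * n) / (2 * n).factorial) = G at *
  rw [hm] at hQ key ⊢
  rw [show m + 1 - 1 = m from rfl] at hQ
  refine mul_right_cancel₀ hz ?_
  linear_combination (-1) * key + G * (y + z) * y * hQ

end Coth

/-! ### Coefficient extraction in two variables -/

/-- The coefficient of `Xʳ Yˢ` in `((1 + X)ᵐ - (1 + Y)ᵐ) / (X - Y)`, computed in two ways. -/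
lemma sum_range_choose_mul_choose (m r s : ℕ) :
    ∑ i ∈ range m, i.choose r * (m - 1 - i).choose s = m.choose (r + s + 1) := by
  induction m generalizing s with
  | zero => simp
  | succ m ih =>
    cases s with
    | zero =>
      have := ih 0
      simp only [Nat.choose_zero_right, mul_one, add_zero] at this ⊢
      rw [sum_range_succ, this, Nat.choose_succ_succ, add_comm]
    | succ s =>
      rw [sum_range_succ, show r + (s + 1) + 1 = (r + s + 1) + 1 by ring, Nat.choose_succ_succ,
        ← ih s, show (r + s + 1).succ = r + (s + 1) + 1 by omega, ← ih (s + 1),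
        ← sum_add_distrib]
      simp only [Nat.add_sub_cancel, Nat.sub_self, Nat.choose_zero_succ, mul_zero, add_zero]
      refine sum_congr rfl fun i hi => ?_
      rw [mem_range] at hi
      rw [show m - i = (m - 1 - i) + 1 by omega, Nat.choose_succ_succ, mul_add]

lemma coeff_one_add_X_pow (a r : ℕ) : coeff r ((1 + X : ℚ⟦X⟧) ^ a) = a.choose r := by
  rw [← binomialSeries_nat (R := ℚ), binomialSeries_coeff, Ring.choose_natCast]
  simp

lemma coeff_inv_one_add_X (r : ℕ) : coeff r ((1 + X : ℚ⟦X⟧)⁻¹) = (-1) ^ r := by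
  have h : rescale (-1 : ℚ) (mk 1) * (1 + X) = 1 := by
    have := congrArg (rescale (-1 : ℚ)) (mk_one_mul_one_sub_eq_one ℚ)
    simpa [rescale_X] using this
  rw [← (PowerSeries.eq_inv_iff_mul_eq_one (by simp)).2 h]
  simp [coeff_rescale]

section TwoVariables

variable (r s : ℕ)

lemma coeff_coeff_C_mul_map (u v : ℚ⟦X⟧) :
    coeff r (coeff s (C u * map C v)) = coeff r u * coeff s v := by
  rw [coeff_C_mul, coeff_map, coeff_mul_C]

lemma coeff_coeff_algebraMap_mul (q : ℚ) (F : ℚ⟦X⟧⟦X⟧) :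
    coeff r (coeff s (algebraMap ℚ ℚ⟦X⟧⟦X⟧ q * F)) = q * coeff r (coeff s F) := by
  rw [← Algebra.smul_def, map_rat_smul, map_rat_smul, smul_eq_mul]

/-- The coefficient of `Xʳ Yˢ` in `(X - Y)ᵃ u(X) v(Y)`. -/
lemma coeff_coeff_sub_pow_mul (a : ℕ) (u v : ℚ⟦X⟧) :
    coeff r (coeff s ((C X - X : ℚ⟦X⟧⟦X⟧) ^ a * (C u * map C v)))
      = ∑ i ∈ range (a + 1), (-1) ^ (a - i) * (a.choose i : ℚ) *
          (coeff r (X ^ i * u) * coeff s (X ^ (a - i) * v)) := by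
  rw [sub_eq_add_neg, add_pow, sum_mul, map_sum, map_sum]
  refine sum_congr rfl fun i _ => ?_
  rw [← coeff_coeff_C_mul_map, ← coeff_coeff_algebraMap_mul]
  congr 2
  simp only [map_mul, map_pow, map_neg, map_one, map_natCast, map_X]
  rw [neg_pow X]
  ring

lemma coeff_coeff_sub_pow_mul_C (a b : ℕ) :
    coeff r (coeff s ((C X - X : ℚ⟦X⟧⟦X⟧) ^ a * C ((1 + X) ^ b)))
      = (-1) ^ s * (a.choose s : ℚ) * if a ≤ r + s then (b.choose (r + s - a) : ℚ) else 0 := by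
  have h := coeff_coeff_sub_pow_mul r s a ((1 + X) ^ b) 1
  rw [map_one, mul_one] at h
  rw [h]
  by_cases hs : s ≤ a
  · rw [sum_eq_single (a - s)]
    · rw [Nat.sub_sub_self hs, Nat.choose_symm hs, coeff_X_pow_mul', mul_one, coeff_X_pow_self,
        mul_one, coeff_one_add_X_pow, show r - (a - s) = r + s - a by omega]
      simp only [show a - s ≤ r ↔ a ≤ r + s by omega]
    · intro i hi hne
      rw [mem_range] at hi
      rw [mul_one, coeff_X_pow, if_neg (by omega), mul_zero, mul_zero]
    · intro hi
      exact absurd (mem_range.2 (by omega)) hi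
  · rw [Nat.choose_eq_zero_of_lt (by omega), Nat.cast_zero, mul_zero, zero_mul]
    refine sum_eq_zero fun i hi => ?_
    rw [mul_one, coeff_X_pow, if_neg (by omega), mul_zero, mul_zero]

lemma coeff_coeff_sub_pow_mul_map (a b : ℕ) :
    coeff r (coeff s ((C X - X : ℚ⟦X⟧⟦X⟧) ^ a * map C ((1 + X) ^ b)))
      = (-1) ^ (a - r) * (a.choose r : ℚ)
        * if a ≤ r + s then (b.choose (r + s - a) : ℚ) else 0 := by
  have h := coeff_coeff_sub_pow_mul r s a 1 ((1 + X) ^ b)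
  rw [map_one, one_mul] at h
  rw [h]
  by_cases hr : r ≤ a
  · rw [sum_eq_single r]
    · rw [mul_one, coeff_X_pow_self, one_mul, coeff_X_pow_mul', coeff_one_add_X_pow,
        show s - (a - r) = r + s - a by omega]
      simp only [show a - r ≤ s ↔ a ≤ r + s by omega]
    · intro i hi hne
      rw [mul_one, coeff_X_pow, if_neg (by omega), zero_mul, mul_zero]
    · intro hi
      exact absurd (mem_range.2 (by omega)) hi
  · rw [Nat.choose_eq_zero_of_lt (by omega), Nat.cast_zero, mul_zero, zero_mul]
    refine sum_eq_zero fun i hi => ?_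
    rw [mem_range] at hi
    rw [mul_one, coeff_X_pow, if_neg (by omega), zero_mul, mul_zero]

lemma coeff_coeff_sub_pow_mul_eq_zero {a : ℕ} (ha : r + s < a) (u v : ℚ⟦X⟧) :
    coeff r (coeff s ((C X - X : ℚ⟦X⟧⟦X⟧) ^ a * (C u * map C v))) = 0 := by
  rw [coeff_coeff_sub_pow_mul]
  refine sum_eq_zero fun i hi => ?_
  rw [coeff_X_pow_mul', coeff_X_pow_mul']
  by_cases h : i ≤ r
  · rw [if_neg (show ¬ a - i ≤ s by omega), mul_zero, mul_zero]
  · rw [if_neg h, zero_mul, mul_zero]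

lemma coeff_coeff_bernoulliConvolution (n : ℕ) (x y : ℚ⟦X⟧⟦X⟧) :
    coeff r (coeff s (bernoulliConvolution n x y))
      = ∑ k ∈ Icc 1 (n - 1), bernoulli (2 * k) / ((2 * k).factorial : ℚ)
        * (bernoulli (2 * (n - k)) / ((2 * (n - k)).factorial : ℚ))
        * coeff r (coeff s (x ^ (2 * k - 1) * y ^ (2 * (n - k) - 1))) := by
  rw [bernoulliConvolution, map_sum, map_sum]
  exact sum_congr rfl fun k _ => coeff_coeff_algebraMap_mul r s _ _

end TwoVariables

/-! ### The convolution identities -/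

/-- The convolution over the full range `1 ≤ k ≤ n - 1`. It is the coefficient of `Xʳ Yˢ` in
`bernoulliConvolution_relation` at `x = 1 + X`, `y = 1 + Y`, `z = X - Y`. -/
lemma sum_bernoulli_mul_choose (r s n : ℕ) (hn : r + s + 2 ≤ n) :
    ∑ k ∈ Icc 1 (n - 1), bernoulli (2 * k) / ((2 * k).factorial : ℚ)
        * (bernoulli (2 * (n - k)) / ((2 * (n - k)).factorial : ℚ))
        * (((2 * k - 1).choose r : ℚ) * ((2 * (n - k) - 1).choose s : ℚ))
    = -(((2 * n - 1).choose (r + s + 1) : ℚ)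
          + cyc (fun a b => (-1 : ℚ) ^ b * ((2 * n - 1).choose a : ℚ)) r s)
        * (bernoulli (2 * n) / ((2 * n).factorial : ℚ))
      - cyc (fun a b => ∑ k ∈ Icc 1 (n - 1), bernoulli (2 * k) / ((2 * k).factorial : ℚ)
        * (bernoulli (2 * (n - k)) / ((2 * (n - k)).factorial : ℚ))
        * ((-1) ^ a * ((2 * k - 1).choose a : ℚ) * if 2 * k ≤ a + b + 1 then
            ((2 * (n - k) - 1).choose (a + b + 1 - 2 * k) : ℚ) else 0)) r s := by
  have hc : constantCoeff (1 + X : ℚ⟦X⟧) ≠ 0 := by simp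
  have hinv : (1 + X : ℚ⟦X⟧) * (1 + X)⁻¹ = 1 := PowerSeries.mul_inv_cancel _ hc
  have h0 : (1 + X : ℚ⟦X⟧) ≠ 0 := fun h => by simp [h] at hc
  have hx : (C (1 + X) : ℚ⟦X⟧⟦X⟧) ≠ 0 := fun h => h0 (C_injective (by simpa using h))
  have hy : (map C (1 + X) : ℚ⟦X⟧⟦X⟧) ≠ 0 := by
    intro h
    have := congrArg (coeff 0) h
    simp at this
  have hz : (C X - X : ℚ⟦X⟧⟦X⟧) ≠ 0 := by
    intro h
    have := congrArg (coeff 1) h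
    simp at this
  have hxi : (C (1 + X) : ℚ⟦X⟧⟦X⟧) * C (1 + X)⁻¹ = 1 := by rw [← map_mul, hinv, map_one]
  have hyi : (map C (1 + X) : ℚ⟦X⟧⟦X⟧) * map C (1 + X)⁻¹ = 1 := by rw [← map_mul, hinv, map_one]
  have rel := bernoulliConvolution_relation (show 2 ≤ n by omega) hx hy hz
    (by simp only [map_add, map_one, map_X]; ring)
  -- Dividing by `x y` is possible because `1 + X` and `1 + Y` are units.
  have rel' : bernoulliConvolution n (C (1 + X)) (map C (1 + X) : ℚ⟦X⟧⟦X⟧)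
      = algebraMap ℚ _ (bernoulli (2 * n) / (2 * n).factorial)
        * ((C X - X) ^ (2 * n) * (C (1 + X)⁻¹ * map C (1 + X)⁻¹)
          - C ((1 + X) ^ (2 * n - 1)) * map C (1 + X)⁻¹
          - C (1 + X)⁻¹ * map C ((1 + X) ^ (2 * n - 1))
          - ∑ i ∈ range (2 * n - 1), C ((1 + X) ^ i) * map C ((1 + X) ^ (2 * n - 1 - 1 - i)))
        + bernoulliConvolution n (C X - X) (map C (1 + X))
        - bernoulliConvolution n (C X - X) (C (1 + X)) := by
    refine mul_left_cancel₀ (mul_ne_zero hx hy) ?_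
    obtain ⟨m, hm⟩ : ∃ m, 2 * n = m + 1 := ⟨2 * n - 1, by omega⟩
    rw [hm] at rel ⊢
    simp only [Nat.add_sub_cancel, map_pow] at rel ⊢
    generalize (C (1 + X) : ℚ⟦X⟧⟦X⟧) = x at *
    generalize (map C (1 + X) : ℚ⟦X⟧⟦X⟧) = y at *
    generalize (C (1 + X)⁻¹ : ℚ⟦X⟧⟦X⟧) = x' at *
    generalize (map C (1 + X)⁻¹ : ℚ⟦X⟧⟦X⟧) = y' at *
    generalize algebraMap ℚ ℚ⟦X⟧⟦X⟧ _ = G at *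
    linear_combination rel + G * (x ^ (m + 1) * hyi + y ^ (m + 1) * hxi
      - (C X - X) ^ (m + 1) * (x * x' * hyi + hxi))
  have key := congrArg (fun F => coeff r (coeff s F)) rel'
  have hQ : ∑ i ∈ range (2 * n - 1), ((i.choose r : ℚ) * ((2 * n - 1 - 1 - i).choose s : ℚ))
      = ((2 * n - 1).choose (r + s + 1) : ℚ) := by
    rw [← sum_range_choose_mul_choose]
    push_cast
    rfl
  simp only [map_add (coeff s), map_sub (coeff s), map_add (coeff r), map_sub (coeff r), map_sum,
    coeff_coeff_algebraMap_mul,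
    coeff_coeff_sub_pow_mul_eq_zero r s (show r + s < 2 * n by omega), coeff_coeff_C_mul_map,
    coeff_one_add_X_pow, coeff_inv_one_add_X, hQ, coeff_coeff_bernoulliConvolution, ← map_pow,
    coeff_coeff_sub_pow_mul_C, coeff_coeff_sub_pow_mul_map] at key
  -- The exponent `2k - 1` is a truncated subtraction; `1 ≤ k` on the whole range.
  have hzx : ∑ k ∈ Icc 1 (n - 1), bernoulli (2 * k) / ((2 * k).factorial : ℚ)
        * (bernoulli (2 * (n - k)) / ((2 * (n - k)).factorial : ℚ))
        * ((-1) ^ s * ((2 * k - 1).choose s : ℚ) * if 2 * k - 1 ≤ r + s then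
            ((2 * (n - k) - 1).choose (r + s - (2 * k - 1)) : ℚ) else 0)
      = ∑ k ∈ Icc 1 (n - 1), bernoulli (2 * k) / ((2 * k).factorial : ℚ)
        * (bernoulli (2 * (n - k)) / ((2 * (n - k)).factorial : ℚ))
        * ((-1) ^ s * ((2 * k - 1).choose s : ℚ) * if 2 * k ≤ s + r + 1 then
            ((2 * (n - k) - 1).choose (s + r + 1 - 2 * k) : ℚ) else 0) := by
    refine sum_congr rfl fun k hk => ?_
    rw [mem_Icc] at hk
    rw [show r + s - (2 * k - 1) = s + r + 1 - 2 * k by omega]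
    simp only [show 2 * k - 1 ≤ r + s ↔ 2 * k ≤ s + r + 1 by omega]
  have hzy : ∑ k ∈ Icc 1 (n - 1), bernoulli (2 * k) / ((2 * k).factorial : ℚ)
        * (bernoulli (2 * (n - k)) / ((2 * (n - k)).factorial : ℚ))
        * ((-1) ^ (2 * k - 1 - r) * ((2 * k - 1).choose r : ℚ) * if 2 * k - 1 ≤ r + s then
            ((2 * (n - k) - 1).choose (r + s - (2 * k - 1)) : ℚ) else 0)
      = -∑ k ∈ Icc 1 (n - 1), bernoulli (2 * k) / ((2 * k).factorial : ℚ)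
        * (bernoulli (2 * (n - k)) / ((2 * (n - k)).factorial : ℚ))
        * ((-1) ^ r * ((2 * k - 1).choose r : ℚ) * if 2 * k ≤ r + s + 1 then
            ((2 * (n - k) - 1).choose (r + s + 1 - 2 * k) : ℚ) else 0) := by
    rw [← sum_neg_distrib]
    refine sum_congr rfl fun k hk => ?_
    rw [mem_Icc] at hk
    rw [show r + s - (2 * k - 1) = r + s + 1 - 2 * k by omega]
    simp only [show 2 * k - 1 ≤ r + s ↔ 2 * k ≤ r + s + 1 by omega]
    have hsign : (-1 : ℚ) ^ (2 * k - 1 - r) * ((2 * k - 1).choose r : ℚ)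
        = -((-1) ^ r * ((2 * k - 1).choose r : ℚ)) := by
      rcases lt_or_ge (2 * k - 1) r with h | h
      · simp [Nat.choose_eq_zero_of_lt h]
      · have hodd : (-1 : ℚ) ^ (2 * k - 1 - r) * (-1) ^ r = -1 := by
          rw [← pow_add, Nat.sub_add_cancel h]
          exact Odd.neg_one_pow ⟨k - 1, by omega⟩
        have hsq : (-1 : ℚ) ^ r * (-1) ^ r = 1 := by rw [← mul_pow]; simp
        linear_combination (-1 : ℚ) ^ r * ((2 * k - 1).choose r : ℚ) * hodd
          - (-1 : ℚ) ^ (2 * k - 1 - r) * ((2 * k - 1).choose r : ℚ) * hsq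
    rw [hsign]
    ring
  rw [hzx, hzy] at key
  simp only [cyc]
  linear_combination key

theorem corollary2p5 (r₁ r₂ n : ℕ) (hn : r₁ + r₂ + 2 ≤ n) :
    (∑ k ∈ Finset.Icc ((r₁ + r₂) ⌈/⌉ 2 + 1) (n - (r₁ + r₂) ⌈/⌉ 2 - 1),
      bernoulli (2 * k) / (Nat.factorial (2 * k) : ℚ)
        * (bernoulli (2 * (n - k)) / (Nat.factorial (2 * (n - k)) : ℚ))
        * (Nat.choose (2 * k - 1) r₁ : ℚ) * (Nat.choose (2 * (n - k) - 1) r₂ : ℚ))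
    = -((Nat.choose (2 * n - 1) (r₁ + r₂ + 1) : ℚ)
          + cyc (fun a b => (-1 : ℚ) ^ b * (Nat.choose (2 * n - 1) a : ℚ)) r₁ r₂)
        * (bernoulli (2 * n) / (Nat.factorial (2 * n) : ℚ))
      - cyc (fun a b => ∑ k ∈ Finset.Icc (a ⌈/⌉ 2 + 1) ((a + b + 1) / 2),
          (Nat.choose (2 * k - 1) a : ℚ)
            * ((-1 : ℚ) ^ a * (Nat.choose (2 * (n - k) - 1) (a + b + 1 - 2 * k) : ℚ)
                + (Nat.choose (2 * (n - k) - 1) b : ℚ))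
            * (bernoulli (2 * k) / (Nat.factorial (2 * k) : ℚ))
            * (bernoulli (2 * (n - k)) / (Nat.factorial (2 * (n - k)) : ℚ))) r₁ r₂ := by
  have full := sum_bernoulli_mul_choose r₁ r₂ n hn
  -- The range of the inner sums on the right-hand side extends down to `k = 1`: for `2k - 1 < a`
  -- the binomial coefficient vanishes, and for `2k - 1 = a` the number `a` is odd and the two
  -- summands in the bracket cancel.
  have inner (a b : ℕ) (hab : a + b + 2 ≤ n) :
      ∑ k ∈ Finset.Icc (a ⌈/⌉ 2 + 1) ((a + b + 1) / 2),
          (Nat.choose (2 * k - 1) a : ℚ)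
            * ((-1 : ℚ) ^ a * (Nat.choose (2 * (n - k) - 1) (a + b + 1 - 2 * k) : ℚ)
                + (Nat.choose (2 * (n - k) - 1) b : ℚ))
            * (bernoulli (2 * k) / (Nat.factorial (2 * k) : ℚ))
            * (bernoulli (2 * (n - k)) / (Nat.factorial (2 * (n - k)) : ℚ))
      = ∑ k ∈ Icc 1 (n - 1), bernoulli (2 * k) / ((2 * k).factorial : ℚ)
          * (bernoulli (2 * (n - k)) / ((2 * (n - k)).factorial : ℚ))
          * ((-1) ^ a * ((2 * k - 1).choose a : ℚ) * if 2 * k ≤ a + b + 1 then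
            ((2 * (n - k) - 1).choose (a + b + 1 - 2 * k) : ℚ) else 0)
        + ∑ k ∈ Icc 1 ((a + b + 1) / 2), bernoulli (2 * k) / ((2 * k).factorial : ℚ)
          * (bernoulli (2 * (n - k)) / ((2 * (n - k)).factorial : ℚ))
          * (((2 * k - 1).choose a : ℚ) * ((2 * (n - k) - 1).choose b : ℚ)) := by
    have hsub : Icc 1 ((a + b + 1) / 2) ⊆ Icc 1 (n - 1) := Icc_subset_Icc_right (by omega)
    rw [← sum_subset hsub, ← sum_add_distrib, Nat.ceilDiv_eq_add_pred_div]
    · refine sum_subset_zero_on_sdiff (Icc_subset_Icc_left (by omega)) ?_ ?_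
      · intro k hk
        simp only [mem_sdiff, mem_Icc] at hk
        rw [if_pos (by omega)]
        rcases lt_or_ge (2 * k - 1) a with h | h
        · simp [Nat.choose_eq_zero_of_lt h]
        · have ha : a = 2 * k - 1 := by omega
          have hodd : (-1 : ℚ) ^ a = -1 := Odd.neg_one_pow ⟨k - 1, by omega⟩
          rw [hodd, show a + b + 1 - 2 * k = b by omega]
          ring
      · intro k hk
        rw [mem_Icc] at hk
        rw [if_pos (by omega)]
        ring
    · intro k hk hk'
      rw [mem_Icc] at hk hk'
      rw [if_neg (by omega), mul_zero, mul_zero]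
  -- The full range `1 ≤ k ≤ n - 1` is cut at `c` and `n - c`, where `2c ≤ r₁ + r₂ + 1 < n`; the
  -- upper piece is reflected by `k ↦ n - k`.
  have split : ∑ k ∈ Icc 1 (n - 1), bernoulli (2 * k) / ((2 * k).factorial : ℚ)
        * (bernoulli (2 * (n - k)) / ((2 * (n - k)).factorial : ℚ))
        * (((2 * k - 1).choose r₁ : ℚ) * ((2 * (n - k) - 1).choose r₂ : ℚ))
      = ∑ k ∈ Icc 1 ((r₁ + r₂ + 1) / 2), bernoulli (2 * k) / ((2 * k).factorial : ℚ)
          * (bernoulli (2 * (n - k)) / ((2 * (n - k)).factorial : ℚ))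
          * (((2 * k - 1).choose r₁ : ℚ) * ((2 * (n - k) - 1).choose r₂ : ℚ))
        + (∑ k ∈ Finset.Icc ((r₁ + r₂) ⌈/⌉ 2 + 1) (n - (r₁ + r₂) ⌈/⌉ 2 - 1),
      bernoulli (2 * k) / (Nat.factorial (2 * k) : ℚ)
        * (bernoulli (2 * (n - k)) / (Nat.factorial (2 * (n - k)) : ℚ))
        * (Nat.choose (2 * k - 1) r₁ : ℚ) * (Nat.choose (2 * (n - k) - 1) r₂ : ℚ))
        + ∑ k ∈ Icc 1 ((r₂ + r₁ + 1) / 2), bernoulli (2 * k) / ((2 * k).factorial : ℚ)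
          * (bernoulli (2 * (n - k)) / ((2 * (n - k)).factorial : ℚ))
          * (((2 * k - 1).choose r₂ : ℚ) * ((2 * (n - k) - 1).choose r₁ : ℚ)) := by
    rw [Nat.ceilDiv_eq_add_pred_div, add_comm r₂ r₁,
      show r₁ + r₂ + 2 - 1 = r₁ + r₂ + 1 from rfl]
    obtain ⟨c, hc⟩ : ∃ c, (r₁ + r₂ + 1) / 2 = c := ⟨_, rfl⟩
    rw [hc]
    have hcn : 2 * c < n := by omega
    have e1 : Icc 1 (n - 1) = Ico 1 n := by ext; simp only [mem_Icc, mem_Ico]; omega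
    have e2 : Icc 1 c = Ico 1 (c + 1) := by ext; simp only [mem_Icc, mem_Ico]; omega
    have e3 : Icc (c + 1) (n - c - 1) = Ico (c + 1) (n - c) := by ext; simp only [mem_Icc, mem_Ico]; omega
    rw [e1, e3, ← sum_Ico_consecutive _ (show 1 ≤ n - c by omega) (show n - c ≤ n by omega),
      ← sum_Ico_consecutive _ (show 1 ≤ c + 1 by omega) (show c + 1 ≤ n - c by omega), e2]
    congr 1
    · simp only [mul_assoc]
    · refine sum_nbij' (fun k => n - k) (fun k => n - k) ?_ ?_ ?_ ?_ ?_
      · intro k hk; simp only [mem_Ico] at *; omega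
      · intro k hk; simp only [mem_Ico] at *; omega
      · intro k hk; simp only [mem_Ico] at *; omega
      · intro k hk; simp only [mem_Ico] at *; omega
      · intro k hk
        simp only [mem_Ico] at hk
        rw [show n - (n - k) = k by omega]
        ring
  rw [split] at full
  simp only [cyc] at full ⊢
  rw [inner r₁ r₂ hn, inner r₂ r₁ (by omega)]
  linear_combination full
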